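/- Let $a<b$ and $0<T\le\infty$. Let $X_0:\mathbb{R}\to\mathbb{R}^2$ be a smooth $(b-a)$-periodic regular parametrization of a simple closed convex plane curve (injective on $[a,b)$, oriented counterclockwise). For a regular closed curve with $(b-a)$-periodic parameter $u$ write $g=|X_u|$, $ds=g\,du$, $\partial_s=\frac1g\partial_u$, $\mathsf{T}=\partial_sX$ for the unit tangent, $\theta$ for the direction angle of $\mathsf{T}$, $\kappa=\partial_s\theta$ for the signed curvature, $\mathsf{N}=\frac1\kappa\partial_s\mathsf{T}$ for the unit normal and $\partial_\theta=\frac1\kappa\partial_s$ (where $\kappa\ne0$), $L=\oint ds$ for the length, and $A=\frac12\oint x\,dy-y\,dx$ for the enclosed area, all integrals being taken over the period $[a,b]$. Let $X(u,t)$, $u\in\mathbb{R}$, $t\in[0,T)$, be a smooth family of regular curves (smooth up to $t=0$), $(b-a)$-periodic in $u$, with nowhere vanishing curvature, which satisfies $$\frac{\partial X}{\partial t}=\eta\,\mathsf{T}+\Big(\kappa-\frac{\lambda(t)}{\kappa}\Big)\mathsf{N},\qquad X(u,0)=X_0(u),$$ where $$\lambda(t)=\frac{2\pi}{\oint\frac1\kappa\,ds},\qquad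 \eta=-\frac{\partial}{\partial\theta}\Big(\kappa-\frac{\lambda(t)}{\kappa}\Big).$$ Then the area $A(t)$ and the length $L(t)$ of the curve $X(\cdot,t)$ are differentiable on $[0,T)$ (one-sided at $t=0$), and for every $t\in[0,T)$ $$\frac{dA}{dt}=0,\qquad \frac{dL}{dt}\le0.$$ -/

import Mathlib

open scoped ContDiff RealInnerProductSpace

noncomputable section

namespace CurveFlow

/-- The Euclidean plane. -/
abbrev Plane := EuclideanSpace ℝ (Fin 2)

/-- Rotation of the plane by a right angle, counterclockwise. -/
def rot (v : Plane) : Plane := !₂[-v 1, v 0]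

/-- The metric `g = |γ_u|` along a parametrized curve `γ`. -/
def speed (γ : ℝ → Plane) (u : ℝ) : ℝ := ‖deriv γ u‖

/-- The derivative `∂f/∂s = (1/g) ∂f/∂u` of a function `f` along `γ` with respect to
the arc length of `γ`. -/
def arcDeriv {E : Type*} [NormedAddCommGroup E] [NormedSpace ℝ E]
    (γ : ℝ → Plane) (f : ℝ → E) (u : ℝ) : E :=
  (speed γ u)⁻¹ • deriv f u

/-- The unit tangent vector `T = ∂γ/∂s`. -/
def tangent (γ : ℝ → Plane) : ℝ → Plane := arcDeriv γ γ

/-- The signed curvature, `⟪∂T/∂s, rot T⟫`. If `θ` is a (differentiable) direction angle of the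
curve, that is `T = (cos θ, sin θ)`, then `∂T/∂s = (∂θ/∂s) rot T` and this number is `∂θ/∂s`. -/
def curvature (γ : ℝ → Plane) (u : ℝ) : ℝ :=
  ⟪arcDeriv γ (tangent γ) u, rot (tangent γ u)⟫

/-- The unit normal vector `N = (1/κ) ∂T/∂s`, at points where the curvature does not vanish. -/
def normal (γ : ℝ → Plane) (u : ℝ) : Plane :=
  (curvature γ u)⁻¹ • arcDeriv γ (tangent γ) u

/-- The derivative `∂f/∂θ = (1/κ) ∂f/∂s` of a function along `γ` with respect to the direction
angle, at points where the curvature does not vanish. -/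
def angleDeriv (γ : ℝ → Plane) (f : ℝ → ℝ) (u : ℝ) : ℝ :=
  (curvature γ u)⁻¹ * arcDeriv γ f u

/-- The length `L = ∮ ds`. -/
def length (a b : ℝ) (γ : ℝ → Plane) : ℝ := ∫ u in a..b, speed γ u

/-- The (algebraic) enclosed area `A = (1/2) ∮ x dy - y dx`. -/
def area (a b : ℝ) (γ : ℝ → Plane) : ℝ :=
  (1 / 2) * ∫ u in a..b, (γ u 0 * deriv γ u 1 - γ u 1 * deriv γ u 0)

/-- The nonlocal term `λ = 2π / ∮ (1/κ) ds`. -/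
def nonlocalTerm (a b : ℝ) (γ : ℝ → Plane) : ℝ :=
  2 * Real.pi / ∫ u in a..b, (1 / curvature γ u) * speed γ u

/-- The normal component `κ - λ/κ` of the velocity. -/
def normalSpeed (a b : ℝ) (γ : ℝ → Plane) (u : ℝ) : ℝ :=
  curvature γ u - nonlocalTerm a b γ / curvature γ u

/-- The tangential component `η = -∂/∂θ (κ - λ/κ)` of the velocity. -/
def tangentialSpeed (a b : ℝ) (γ : ℝ → Plane) (u : ℝ) : ℝ :=
  -angleDeriv γ (normalSpeed a b γ) u

/-- `γ` is a smooth, regular, simple closed convex plane curve, parametrized counterclockwise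
over the period `[a, b]`: the curve lies on one side of each of its tangent lines, namely on the
left-hand side. -/
structure IsConvexClosedCurve (a b : ℝ) (γ : ℝ → Plane) : Prop where
  smooth : ContDiff ℝ ∞ γ
  periodic : Function.Periodic γ (b - a)
  regular : ∀ u, deriv γ u ≠ 0
  simple : Set.InjOn γ (Set.Ico a b)
  convex : ∀ u v, 0 ≤ ⟪γ v - γ u, rot (tangent γ u)⟫

/-- The time interval `[0, T)`, where `T` may be `∞`. -/
def timeInterval (T : EReal) : Set ℝ := {t | 0 ≤ t ∧ (t : EReal) < T}

/-- `X u t` is a smooth solution on `[0, T)`, with initial curve `X₀`, of the flow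
`∂X/∂t = η T + (κ - λ/κ) N` of regular closed plane curves. The nonvanishing of the curvature is
what is needed for the right-hand side of the equation to make sense. At `t = 0` the time
derivative is one-sided. -/
structure IsSolution (a b : ℝ) (T : EReal) (X₀ : ℝ → Plane) (X : ℝ → ℝ → Plane) : Prop where
  smooth : ContDiffOn ℝ ∞ (fun p : ℝ × ℝ => X p.1 p.2) (Set.univ ×ˢ timeInterval T)
  periodic : ∀ t ∈ timeInterval T, Function.Periodic (fun u => X u t) (b - a)
  regular : ∀ t ∈ timeInterval T, ∀ u, deriv (fun v => X v t) u ≠ 0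
  curvature_ne_zero : ∀ t ∈ timeInterval T, ∀ u, curvature (fun v => X v t) u ≠ 0
  evolution : ∀ t ∈ timeInterval T, ∀ u,
    HasDerivWithinAt (fun τ => X u τ)
      (tangentialSpeed a b (fun v => X v t) u • tangent (fun v => X v t) u
        + normalSpeed a b (fun v => X v t) u • normal (fun v => X v t) u)
      (timeInterval T) t
  initial : ∀ u, X u 0 = X₀ u

end CurveFlow

end

/-! Only the normal component of the velocity changes length and area: if a family of closed
curves has normal speed `F`, the first variation formulas read `dL/dt = -∮ κ F ds` and
`dA/dt = -∮ F ds`.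

The tangent of a regular curve turns through `∮ κ ds`, which for a closed curve lies in `2π ℤ` and
hence does not change with `t`. For the initial curve it equals `2π`: two points of a convex curve
with equal tangent directions lie on a common tangent line, and then coincide, so that a simple
curve turns only once. Therefore `∮ (κ - λ/κ) ds = 2π - 2π = 0` and the area is constant.

Since `F = κ - λ/κ` has the sign of `κ - √λ`, we have `κ F ≥ √λ F`, and integration gives
`∮ κ F ds ≥ √λ ∮ F ds = 0`. -/

noncomputable section

namespace CurveFlow

open Set Filter Topology MeasureTheory Function

/-! ### Integrals and derivatives depending on a parameter -/

section Parametric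

variable {E : Type*} [NormedAddCommGroup E] [NormedSpace ℝ E] {S : Set ℝ} {a b : ℝ}

lemma continuousOn_intervalIntegral {α : Type*} [TopologicalSpace α] {A : Set α}
    {G : ℝ → α → E} (hG : ContinuousOn (uncurry G) (univ ×ˢ A)) :
    ContinuousOn (fun t => ∫ u in a..b, G u t) A := by
  rw [continuousOn_iff_continuous_domRestrict]
  exact intervalIntegral.continuous_parametric_intervalIntegral_of_continuous'
    (f := fun (t : A) u => G u t)
    (hG.comp_continuous (f := fun p : A × ℝ => (p.2, (p.1 : α))) (by fun_prop)
      fun p => ⟨mem_univ _, p.1.2⟩) a b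

lemma eventually_norm_slope_le_norm_add_one (hS : Convex ℝ S) {K : Set ℝ} (hK : IsCompact K)
    {F F' : ℝ → ℝ → E} (hF' : ContinuousOn (uncurry F') (K ×ˢ S))
    (hd : ∀ u ∈ K, ∀ t ∈ S, HasDerivWithinAt (F u) (F' u t) S t) {t : ℝ} (ht : t ∈ S) :
    ∀ᶠ τ in 𝓝[S] t, ∀ u ∈ K, ‖slope (F u) t τ‖ ≤ ‖F' u t‖ + 1 := by
  have hswap : ContinuousOn (uncurry fun τ u => F' u τ) (S ×ˢ K) :=
    hF'.comp continuous_swap.continuousOn fun p hp => ⟨hp.2, hp.1⟩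
  obtain ⟨v, hv, hclose⟩ := hK.mem_uniformity_of_prod hswap ht (Metric.dist_mem_uniformity one_pos)
  obtain ⟨r, hr, hrv⟩ := Metric.mem_nhdsWithin_iff.1 hv
  filter_upwards [inter_mem_nhdsWithin S (Metric.ball_mem_nhds t hr)] with τ hτ u hu
  have hbound : ∀ σ ∈ S ∩ Metric.ball t r, ‖F' u σ‖ ≤ ‖F' u t‖ + 1 := fun σ hσ => by
    have hdist : dist (F' u σ) (F' u t) < 1 := hclose σ (hrv ⟨hσ.2, hσ.1⟩) u hu
    rw [dist_eq_norm] at hdist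
    linarith [norm_le_norm_add_norm_sub' (F' u σ) (F' u t)]
  have hlip := Convex.norm_image_sub_le_of_norm_hasDerivWithin_le
    (fun σ hσ => (hd u hu σ hσ.1).mono inter_subset_left) hbound
    (hS.inter (convex_ball t r)) ⟨ht, Metric.mem_ball_self hr⟩ hτ
  rw [slope_def_module, norm_smul, norm_inv, inv_mul_eq_div]
  exact div_le_of_le_mul₀ (norm_nonneg _) (by positivity) hlip

theorem hasDerivWithinAt_intervalIntegral (hS : Convex ℝ S) {F F' : ℝ → ℝ → E}
    (hF : ∀ t ∈ S, IntervalIntegrable (F · t) volume a b)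
    (hF' : ContinuousOn (uncurry F') (uIcc a b ×ˢ S))
    (hd : ∀ u ∈ uIcc a b, ∀ t ∈ S, HasDerivWithinAt (F u) (F' u t) S t) {t : ℝ} (ht : t ∈ S) :
    HasDerivWithinAt (fun τ => ∫ u in a..b, F u τ) (∫ u in a..b, F' u t) S t := by
  rw [hasDerivWithinAt_iff_tendsto_slope]
  have hslope : ∀ᶠ τ in 𝓝[S \ {t}] t,
      ∫ u in a..b, slope (F u) t τ = slope (fun τ => ∫ u in a..b, F u τ) t τ := by
    filter_upwards [self_mem_nhdsWithin] with τ hτ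
    simp only [slope_def_module]
    rw [intervalIntegral.integral_smul, intervalIntegral.integral_sub (hF τ hτ.1) (hF t ht)]
  refine Tendsto.congr' hslope
    (intervalIntegral.tendsto_integral_filter_of_dominated_convergence
      (fun u => ‖F' u t‖ + 1) ?_ ?_ ?_ ?_)
  · filter_upwards [self_mem_nhdsWithin] with τ hτ
    simp only [slope_def_module]
    exact (((hF τ hτ.1).sub (hF t ht)).smul (τ - t)⁻¹).def'.aestronglyMeasurable
  · filter_upwards [nhdsWithin_mono t sdiff_subset
      (eventually_norm_slope_le_norm_add_one hS isCompact_uIcc hF' hd ht)] with τ hτ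
    exact Eventually.of_forall fun u hu => hτ u (uIoc_subset_uIcc hu)
  · have hslice : ContinuousOn (F' · t) (uIcc a b) :=
      hF'.comp (f := fun u => (u, t)) (by fun_prop) fun u hu => ⟨hu, ht⟩
    exact (hslice.norm.add continuousOn_const).intervalIntegrable
  · exact Eventually.of_forall fun u hu =>
      (hasDerivWithinAt_iff_tendsto_slope.1 (hd u (uIoc_subset_uIcc hu) t ht))

variable {X : ℝ → ℝ → E} {m n : WithTop ℕ∞} {t : ℝ}

lemma contDiff_slice (hX : ContDiffOn ℝ n (uncurry X) (univ ×ˢ S)) (ht : t ∈ S) :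
    ContDiff ℝ n (X · t) :=
  contDiffOn_univ.1 <| hX.comp (f := fun u => (u, t)) (by fun_prop) fun _ _ => ⟨mem_univ _, ht⟩

lemma continuous_slice {Y : Type*} [TopologicalSpace Y] {G : ℝ → ℝ → Y}
    (hG : ContinuousOn (uncurry G) (univ ×ˢ S)) (ht : t ∈ S) : Continuous (G · t) :=
  hG.comp_continuous (f := fun u => (u, t)) (by fun_prop) fun _ => ⟨mem_univ _, ht⟩

lemma hasDerivAt_fderivWithin_uncurry (hX : DifferentiableOn ℝ (uncurry X) (univ ×ˢ S))
    (ht : t ∈ S) (u : ℝ) :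
    HasDerivAt (X · t) (fderivWithin ℝ (uncurry X) (univ ×ˢ S) (u, t) (1, 0)) u := by
  have hline : HasDerivWithinAt (fun v => (v, t)) ((1 : ℝ), (0 : ℝ)) univ u :=
    (hasDerivWithinAt_id u _).prodMk (hasDerivWithinAt_const u _ t)
  exact hasDerivWithinAt_univ.1 <| (hX (u, t) ⟨mem_univ _, ht⟩).hasFDerivWithinAt
    |>.comp_hasDerivWithinAt (f := fun v => (v, t)) u hline fun _ _ => ⟨mem_univ _, ht⟩

lemma hasDerivWithinAt_fderivWithin_uncurry (hX : DifferentiableOn ℝ (uncurry X) (univ ×ˢ S))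
    (ht : t ∈ S) (u : ℝ) :
    HasDerivWithinAt (X u) (fderivWithin ℝ (uncurry X) (univ ×ˢ S) (u, t) (0, 1)) S t := by
  have hline : HasDerivWithinAt (fun τ => (u, τ)) ((0 : ℝ), (1 : ℝ)) S t :=
    (hasDerivWithinAt_const t _ u).prodMk (hasDerivWithinAt_id t _)
  exact (hX (u, t) ⟨mem_univ _, ht⟩).hasFDerivWithinAt
    |>.comp_hasDerivWithinAt (f := fun τ => (u, τ)) t hline fun _ hτ => ⟨mem_univ _, hτ⟩

lemma hasDerivWithinAt_derivWithin (hX : DifferentiableOn ℝ (uncurry X) (univ ×ˢ S)) (ht : t ∈ S)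
    (u : ℝ) : HasDerivWithinAt (X u) (derivWithin (X u) S t) S t :=
  (hasDerivWithinAt_fderivWithin_uncurry hX ht u).differentiableWithinAt.hasDerivWithinAt

lemma contDiffOn_uncurry_deriv (hS : UniqueDiffOn ℝ S)
    (hX : ContDiffOn ℝ n (uncurry X) (univ ×ˢ S)) (hmn : m + 1 ≤ n) :
    ContDiffOn ℝ m (uncurry fun u t => deriv (X · t) u) (univ ×ˢ S) :=
  ((hX.fderivWithin (uniqueDiffOn_univ.prod hS) hmn).clm_apply
    (contDiffOn_const (c := ((1 : ℝ), (0 : ℝ))))).congr fun p hp =>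
      (hasDerivAt_fderivWithin_uncurry (hX.differentiableOn (by aesop)) hp.2 p.1).deriv

lemma contDiffOn_uncurry_derivWithin (hS : UniqueDiffOn ℝ S)
    (hX : ContDiffOn ℝ n (uncurry X) (univ ×ˢ S)) (hmn : m + 1 ≤ n) :
    ContDiffOn ℝ m (uncurry fun u t => derivWithin (X u) S t) (univ ×ˢ S) :=
  ((hX.fderivWithin (uniqueDiffOn_univ.prod hS) hmn).clm_apply
    (contDiffOn_const (c := ((0 : ℝ), (1 : ℝ))))).congr fun p hp =>
      (hasDerivWithinAt_fderivWithin_uncurry (hX.differentiableOn (by aesop)) hp.2 p.1).derivWithin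
        (hS p.2 hp.2)

lemma derivWithin_deriv_comm (hS : UniqueDiffOn ℝ S) (hSi : S ⊆ closure (interior S))
    (hX : ContDiffOn ℝ 2 (uncurry X) (univ ×ˢ S)) (ht : t ∈ S) (u : ℝ) :
    derivWithin (fun τ => deriv (X · τ) u) S t = deriv (fun v => derivWithin (X v) S t) u := by
  set D := fderivWithin ℝ (uncurry X) (univ ×ˢ S)
  have hp : (u, t) ∈ (univ : Set ℝ) ×ˢ S := ⟨mem_univ _, ht⟩
  have hU := (uniqueDiffOn_univ (𝕜 := ℝ) (E := ℝ)).prod hS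
  have hXd := hX.differentiableOn two_ne_zero
  have hD : DifferentiableOn ℝ D (univ ×ˢ S) :=
    (hX.fderivWithin hU one_add_one_eq_two.le).differentiableOn one_ne_zero
  have hDapply (w : ℝ × ℝ) : DifferentiableOn ℝ (uncurry fun v τ => D (v, τ) w) (univ ×ˢ S) :=
    hD.clm_apply (differentiableOn_const w)
  have hsecond (w z : ℝ × ℝ) :
      fderivWithin ℝ (uncurry fun v τ => D (v, τ) w) (univ ×ˢ S) (u, t) z
        = fderivWithin ℝ D (univ ×ˢ S) (u, t) z w := by
    change fderivWithin ℝ (fun p => D p w) (univ ×ˢ S) (u, t) z = _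
    rw [fderivWithin_clm_apply (hU _ hp) (hD _ hp) (differentiableWithinAt_const w)]
    simp
  have hclosure : (u, t) ∈ closure (interior ((univ : Set ℝ) ×ˢ S)) := by
    rw [interior_prod_eq, closure_prod_eq, interior_univ, closure_univ]
    exact ⟨mem_univ _, hSi ht⟩
  have hsymm : IsSymmSndFDerivWithinAt ℝ (uncurry X) (univ ×ˢ S) (u, t) :=
    (hX _ hp).isSymmSndFDerivWithinAt (by simp) hU hclosure hp
  calc derivWithin (fun τ => deriv (X · τ) u) S t
      = derivWithin (fun τ => D (u, τ) (1, 0)) S t :=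
        derivWithin_congr (fun τ hτ => (hasDerivAt_fderivWithin_uncurry hXd hτ u).deriv)
          (hasDerivAt_fderivWithin_uncurry hXd ht u).deriv
    _ = fderivWithin ℝ D (univ ×ˢ S) (u, t) (0, 1) (1, 0) := by
        rw [← hsecond]
        exact (hasDerivWithinAt_fderivWithin_uncurry (hDapply _) ht u).derivWithin (hS t ht)
    _ = fderivWithin ℝ D (univ ×ˢ S) (u, t) (1, 0) (0, 1) := hsymm _ _
    _ = deriv (fun v => D (v, t) (0, 1)) u := by
        rw [← hsecond]
        exact (hasDerivAt_fderivWithin_uncurry (hDapply _) ht u).deriv.symm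
    _ = deriv (fun v => derivWithin (X v) S t) u := by
        congr 1 with v
        exact ((hasDerivWithinAt_fderivWithin_uncurry hXd ht v).derivWithin (hS t ht)).symm

lemma hasDerivWithinAt_deriv (hS : UniqueDiffOn ℝ S) (hSi : S ⊆ closure (interior S))
    (hX : ContDiffOn ℝ 2 (uncurry X) (univ ×ˢ S)) (ht : t ∈ S) (u : ℝ) :
    HasDerivWithinAt (fun τ => deriv (X · τ) u) (deriv (fun v => derivWithin (X v) S t) u) S t := by
  rw [← derivWithin_deriv_comm hS hSi hX ht u]
  exact hasDerivWithinAt_derivWithin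
    ((contDiffOn_uncurry_deriv hS hX one_add_one_eq_two.le).differentiableOn one_ne_zero) ht u

end Parametric

section InnerProduct

variable {E : Type*} [NormedAddCommGroup E] [InnerProductSpace ℝ E] {a b : ℝ}

lemma hasDerivWithinAt_norm {f : ℝ → E} {f' : E} {S : Set ℝ} {t : ℝ}
    (hf : HasDerivWithinAt f f' S t) (h0 : f t ≠ 0) :
    HasDerivWithinAt (fun τ => ‖f τ‖) ⟪‖f t‖⁻¹ • f t, f'⟫ S t := by
  have hsqrt := hf.norm_sq.sqrt (pow_ne_zero 2 (norm_ne_zero_iff.2 h0))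
  simp only [Real.sqrt_sq (norm_nonneg _)] at hsqrt
  refine hsqrt.congr_deriv ?_
  rw [real_inner_smul_left]
  field_simp

lemma integral_inner_deriv_eq_neg {f g : ℝ → E} (hf : ContDiff ℝ 1 f) (hg : ContDiff ℝ 1 g)
    (hfab : f b = f a) (hgab : g b = g a) :
    ∫ u in a..b, ⟪f u, deriv g u⟫ = -∫ u in a..b, ⟪deriv f u, g u⟫ := by
  have hfg' : Continuous fun u => ⟪f u, deriv g u⟫ :=
    hf.continuous.inner (hg.continuous_deriv le_rfl)
  have hf'g : Continuous fun u => ⟪deriv f u, g u⟫ :=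
    (hf.continuous_deriv le_rfl).inner hg.continuous
  have hftc : ∫ u in a..b, (⟪f u, deriv g u⟫ + ⟪deriv f u, g u⟫) = ⟪f b, g b⟫ - ⟪f a, g a⟫ :=
    intervalIntegral.integral_eq_sub_of_hasDerivAt
      (fun u _ => (hf.differentiable one_ne_zero u).hasDerivAt.inner ℝ
        (hg.differentiable one_ne_zero u).hasDerivAt)
      ((hfg'.add hf'g).intervalIntegrable a b)
  rw [intervalIntegral.integral_add (hfg'.intervalIntegrable _ _) (hf'g.intervalIntegrable _ _),
    hfab, hgab, sub_self] at hftc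
  exact eq_neg_of_add_eq_zero_left hftc

end InnerProduct

/-! ### Rotation of the plane -/

/-- The counterclockwise rotation `rot` by a right angle, bundled as a continuous linear map. -/
def rotL : Plane →L[ℝ] Plane :=
  LinearMap.toContinuousLinearMap
    { toFun := rot
      map_add' := fun v w => by ext i; fin_cases i <;> simp [rot, add_comm]
      map_smul' := fun c v => by ext i; fin_cases i <;> simp [rot] }

lemma rot_smul (c : ℝ) (v : Plane) : rot (c • v) = c • rot v := map_smul rotL c v

lemma rot_rot (v : Plane) : rot (rot v) = -v := by
  ext i; fin_cases i <;> simp [rot]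

lemma inner_eq_sum (v w : Plane) : ⟪v, w⟫ = v 0 * w 0 + v 1 * w 1 := by
  simp [PiLp.inner_apply, Fin.sum_univ_two, mul_comm]

lemma inner_rot_left (v w : Plane) : ⟪rot v, w⟫ = -⟪v, rot w⟫ := by
  simp only [inner_eq_sum, rot, Matrix.cons_val_zero, Matrix.cons_val_one]
  ring

lemma inner_rot_rot (v w : Plane) : ⟪rot v, rot w⟫ = ⟪v, w⟫ := by
  rw [inner_rot_left, rot_rot, inner_neg_right, neg_neg]

lemma inner_self_rot (v : Plane) : ⟪v, rot v⟫ = 0 := by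
  linarith [inner_rot_left v v, real_inner_comm v (rot v)]

lemma eq_inner_rot_smul_rot {v w : Plane} (hv : ‖v‖ = 1) (hw : ⟪w, v⟫ = 0) :
    w = ⟪w, rot v⟫ • rot v := by
  have hv' : v 0 * v 0 + v 1 * v 1 = 1 := by
    rw [← inner_eq_sum, real_inner_self_eq_norm_sq, hv, one_pow]
  rw [inner_eq_sum] at hw
  ext i
  fin_cases i <;> simp [inner_eq_sum, rot]
  · linear_combination (-w 0) * hv' + v 0 * hw
  · linear_combination (-w 1) * hv' + v 1 * hw

lemma continuous_rot : Continuous rot := rotL.continuous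

lemma contDiff_rot {n : WithTop ℕ∞} : ContDiff ℝ n rot := rotL.contDiff

lemma hasDerivAt_rot {f : ℝ → Plane} {f' : Plane} {u : ℝ} (hf : HasDerivAt f f' u) :
    HasDerivAt (fun v => rot (f v)) (rot f') u :=
  rotL.hasFDerivAt.comp_hasDerivAt u hf

lemma hasDerivWithinAt_rot {f : ℝ → Plane} {f' : Plane} {S : Set ℝ} {t : ℝ}
    (hf : HasDerivWithinAt f f' S t) : HasDerivWithinAt (fun τ => rot (f τ)) (rot f') S t :=
  rotL.hasFDerivAt.comp_hasDerivWithinAt t hf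

/-! ### Regular curves -/

section RegularCurve

variable {γ : ℝ → Plane} {u : ℝ}

lemma speed_pos (hu : deriv γ u ≠ 0) : 0 < speed γ u := norm_pos_iff.2 hu

lemma speed_smul_tangent (hu : deriv γ u ≠ 0) : speed γ u • tangent γ u = deriv γ u :=
  smul_inv_smul₀ (speed_pos hu).ne' _

lemma norm_tangent (hu : deriv γ u ≠ 0) : ‖tangent γ u‖ = 1 :=
  norm_smul_inv_norm (𝕜 := ℝ) hu

lemma inner_tangent_self (hu : deriv γ u ≠ 0) : ⟪tangent γ u, tangent γ u⟫ = 1 := by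
  rw [real_inner_self_eq_norm_sq, norm_tangent hu, one_pow]

lemma periodic_deriv {E : Type*} [NormedAddCommGroup E] [NormedSpace ℝ E] {f : ℝ → E} {c : ℝ}
    (hf : Periodic f c) : Periodic (deriv f) c := fun u => by
  rw [← deriv_comp_add_const, hf.funext]

lemma periodic_tangent {c : ℝ} (hγ : Periodic γ c) : Periodic (tangent γ) c := fun u => by
  simp only [tangent, arcDeriv, speed, periodic_deriv hγ u]

lemma curvature_mul_speed (hu : deriv γ u ≠ 0) :
    curvature γ u * speed γ u = ⟪deriv (tangent γ) u, rot (tangent γ u)⟫ := by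
  rw [curvature, arcDeriv, real_inner_smul_left, mul_comm, mul_inv_cancel_left₀ (speed_pos hu).ne']

variable (hγ : ContDiff ℝ 2 γ) (hr : ∀ u, deriv γ u ≠ 0)
include hγ

lemma continuous_speed : Continuous (speed γ) := (hγ.continuous_deriv one_le_two).norm

include hr

lemma contDiff_tangent : ContDiff ℝ 1 (tangent γ) := by
  have hγ' : ContDiff ℝ 1 (deriv γ) := hγ.deriv'
  exact ((hγ'.norm ℝ hr).inv fun u => (speed_pos (hr u)).ne').smul hγ'

lemma hasDerivAt_tangent (u : ℝ) : HasDerivAt (tangent γ) (deriv (tangent γ) u) u :=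
  ((contDiff_tangent hγ hr).differentiable one_ne_zero u).hasDerivAt

lemma inner_deriv_tangent_tangent (u : ℝ) : ⟪deriv (tangent γ) u, tangent γ u⟫ = 0 := by
  have hT := hasDerivAt_tangent hγ hr u
  have hconst : (fun v => ⟪tangent γ v, tangent γ v⟫) = fun _ => (1 : ℝ) :=
    funext fun v => inner_tangent_self (hr v)
  have hderiv := (hconst ▸ hT.inner ℝ hT).unique (hasDerivAt_const u (1 : ℝ))
  linarith [real_inner_comm (tangent γ u) (deriv (tangent γ) u)]

theorem deriv_tangent (u : ℝ) :
    deriv (tangent γ) u = (curvature γ u * speed γ u) • rot (tangent γ u) := by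
  rw [curvature_mul_speed (hr u)]
  exact eq_inner_rot_smul_rot (norm_tangent (hr u)) (inner_deriv_tangent_tangent hγ hr u)

lemma normal_eq_rot_tangent {u : ℝ} (hκ : curvature γ u ≠ 0) :
    normal γ u = rot (tangent γ u) := by
  rw [normal, arcDeriv, deriv_tangent hγ hr, mul_comm, mul_smul,
    inv_smul_smul₀ (speed_pos (hr u)).ne', inv_smul_smul₀ hκ]

lemma continuous_curvature : Continuous (curvature γ) := by
  have hT := contDiff_tangent hγ hr
  exact (((continuous_speed hγ).inv₀ fun u => (speed_pos (hr u)).ne').smul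
    (hT.continuous_deriv le_rfl)).inner (continuous_rot.comp hT.continuous)

lemma continuous_curvature_mul_speed : Continuous fun u => curvature γ u * speed γ u :=
  (continuous_curvature hγ hr).mul (continuous_speed hγ)

lemma hasDerivAt_inner_sub_rot_tangent (p : Plane) (u : ℝ) :
    HasDerivAt (fun v => ⟪p - γ v, rot (tangent γ v)⟫)
      (-(curvature γ u * speed γ u) * ⟪p - γ u, tangent γ u⟫) u := by
  have hsub := ((hγ.differentiable two_ne_zero u).hasDerivAt).const_sub p
  refine (hsub.inner ℝ (hasDerivAt_rot (hasDerivAt_tangent hγ hr u))).congr_deriv ?_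
  rw [deriv_tangent hγ hr, ← speed_smul_tangent (hr u), rot_smul, rot_rot, inner_neg_left,
    real_inner_smul_left, inner_self_rot, real_inner_smul_right, inner_neg_right]
  ring

omit hγ hr

/-- The total curvature `∮ κ ds` of `γ` over `[a, b]`: the angle through which the tangent turns. -/
def totalCurvature (a b : ℝ) (γ : ℝ → Plane) : ℝ := ∫ u in a..b, curvature γ u * speed γ u

lemma totalCurvature_symm (a b : ℝ) (γ : ℝ → Plane) :
    totalCurvature b a γ = -totalCurvature a b γ :=
  intervalIntegral.integral_symm a b

include hγ hr

lemma hasDerivAt_totalCurvature (a x : ℝ) :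
    HasDerivAt (totalCurvature a · γ) (curvature γ x * speed γ x) x :=
  ((continuous_curvature_mul_speed hγ hr).integral_hasStrictDerivAt a x).hasDerivAt

theorem tangent_eq_cos_smul_add_sin_smul (a x : ℝ) :
    tangent γ x = Real.cos (totalCurvature a x γ) • tangent γ a
      + Real.sin (totalCurvature a x γ) • rot (tangent γ a) := by
  set w : ℝ → Plane := fun y => Real.cos (totalCurvature x y γ) • tangent γ y
    - Real.sin (totalCurvature x y γ) • rot (tangent γ y) with hw
  have hw' (y : ℝ) : HasDerivAt w 0 y := by
    have hφ := hasDerivAt_totalCurvature hγ hr x y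
    have hT := hasDerivAt_tangent hγ hr y
    refine ((hφ.cos.smul hT).sub (hφ.sin.smul (hasDerivAt_rot hT))).congr_deriv ?_
    rw [deriv_tangent hγ hr, rot_smul, rot_rot]
    module
  have hconst : w x = w a :=
    is_const_of_deriv_eq_zero (fun y => (hw' y).differentiableAt) (fun y => (hw' y).deriv) x a
  have hxx : totalCurvature x x γ = 0 := intervalIntegral.integral_same
  simpa [hw, hxx, totalCurvature_symm a x] using hconst

theorem totalCurvature_mem_zmultiples {a b : ℝ} (hab : tangent γ b = tangent γ a) :
    totalCurvature a b γ ∈ AddSubgroup.zmultiples (2 * Real.pi) := by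
  have hturn := congrArg (⟪·, tangent γ a⟫) (tangent_eq_cos_smul_add_sin_smul hγ hr a b)
  simp only [hab, inner_add_left, real_inner_smul_left, inner_tangent_self (hr a),
    inner_rot_left, inner_self_rot] at hturn
  obtain ⟨n, hn⟩ := (Real.cos_eq_one_iff (totalCurvature a b γ)).1 (by linarith)
  exact AddSubgroup.mem_zmultiples_iff.2 ⟨n, by rw [zsmul_eq_mul, hn]⟩

lemma totalCurvature_pos {a b : ℝ} (hab : a < b) (hκ : ∀ u, 0 < curvature γ u) :
    0 < totalCurvature a b γ :=
  intervalIntegral.intervalIntegral_pos_of_pos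
    ((continuous_curvature_mul_speed hγ hr).intervalIntegrable _ _)
    (fun u => mul_pos (hκ u) (speed_pos (hr u))) hab

lemma curvature_pos_of_totalCurvature_pos {a b : ℝ} (hab : a ≤ b) (hκ : ∀ u, curvature γ u ≠ 0)
    (htotal : 0 < totalCurvature a b γ) (u : ℝ) : 0 < curvature γ u := by
  by_contra! hu
  have hneg (v : ℝ) : curvature γ v ≤ 0 := by
    by_contra! hv
    obtain ⟨w, hw⟩ := mem_range_of_exists_le_of_exists_ge (continuous_curvature hγ hr)
      ⟨u, hu⟩ ⟨v, hv.le⟩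
    exact hκ w hw
  have hnonpos : totalCurvature a b γ ≤ ∫ _ in a..b, (0 : ℝ) :=
    intervalIntegral.integral_mono hab
      ((continuous_curvature_mul_speed hγ hr).intervalIntegrable _ _)
      intervalIntegrable_const
      fun v => mul_nonpos_of_nonpos_of_nonneg (hneg v) (speed_pos (hr v)).le
  exact htotal.not_ge (hnonpos.trans_eq intervalIntegral.integral_zero)

end RegularCurve

/-! ### Convex curves -/

namespace IsConvexClosedCurve

variable {a b : ℝ} {γ : ℝ → Plane} (hγ : IsConvexClosedCurve a b γ)
include hγ

lemma contDiff_two : ContDiff ℝ 2 γ := contDiff_infty.1 hγ.smooth 2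

/-- Adding the convexity inequalities at `u` and at `v` shows that `γ` and `rot T` vary in opposite
directions; comparing their difference quotients gives the sign of `κ`. -/
lemma curvature_nonneg (u : ℝ) : 0 ≤ curvature γ u := by
  have hopposite (v : ℝ) : ⟪γ v - γ u, rot (tangent γ v) - rot (tangent γ u)⟫ ≤ 0 := by
    have hu := hγ.convex u v
    have hv := hγ.convex v u
    rw [← neg_sub, inner_neg_left] at hv
    rw [inner_sub_right]
    linarith
  have hslope (v : ℝ) : ⟪slope γ u v, slope (fun w => rot (tangent γ w)) u v⟫ ≤ 0 := by
    rw [slope_def_module, slope_def_module, real_inner_smul_left, real_inner_smul_right,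
      ← mul_assoc]
    exact mul_nonpos_of_nonneg_of_nonpos (mul_self_nonneg _) (hopposite v)
  have hγ' := (hγ.contDiff_two.differentiable two_ne_zero u).hasDerivAt
  have hN' := hasDerivAt_rot (hasDerivAt_tangent hγ.contDiff_two hγ.regular u)
  have hlimit : ⟪deriv γ u, rot (deriv (tangent γ) u)⟫ ≤ 0 :=
    le_of_tendsto (hγ'.tendsto_slope.inner hN'.tendsto_slope) (Eventually.of_forall hslope)
  have hg := speed_pos (hγ.regular u)
  rw [← speed_smul_tangent (hγ.regular u), deriv_tangent hγ.contDiff_two hγ.regular, rot_smul,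
    rot_rot, real_inner_smul_left, real_inner_smul_right, inner_neg_right,
    inner_tangent_self (hγ.regular u)] at hlimit
  by_contra! hκ
  nlinarith [mul_pos_of_neg_of_neg hκ (neg_neg_of_pos (mul_pos hg hg))]

lemma curvature_pos {u : ℝ} (hκ : curvature γ u ≠ 0) : 0 < curvature γ u :=
  (hγ.curvature_nonneg u).lt_of_ne' hκ

/-- The two points lie on a common tangent line; the distance from `γ v` to the tangent line at `w`
is then minimal at `w = u`, so that its derivative vanishes there. -/
lemma eq_of_tangent_eq {u v : ℝ} (hκ : curvature γ u ≠ 0) (hT : tangent γ u = tangent γ v) :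
    γ u = γ v := by
  have hnormal : ⟪γ v - γ u, rot (tangent γ u)⟫ = 0 := by
    have hv := hγ.convex v u
    rw [← hT, ← neg_sub, inner_neg_left] at hv
    linarith [hγ.convex u v]
  have hmin : IsLocalMin (fun w => ⟪γ v - γ w, rot (tangent γ w)⟫) u :=
    Eventually.of_forall fun w => hnormal.trans_le (hγ.convex w v)
  have htangent : ⟪γ v - γ u, tangent γ u⟫ = 0 := by
    simpa [hκ, (speed_pos (hγ.regular u)).ne'] using
      hmin.hasDerivAt_eq_zero
        (hasDerivAt_inner_sub_rot_tangent hγ.contDiff_two hγ.regular (γ v) u)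
  have hsub := eq_inner_rot_smul_rot (norm_tangent (hγ.regular u)) htangent
  rw [hnormal, zero_smul, sub_eq_zero] at hsub
  exact hsub.symm

lemma totalCurvature_ne_two_pi {x : ℝ} (hx : x ∈ Ioo a b) (hκ : curvature γ x ≠ 0) :
    totalCurvature a x γ ≠ 2 * Real.pi := fun hturn => by
  have hT : tangent γ x = tangent γ a := by
    simpa [hturn] using tangent_eq_cos_smul_add_sin_smul hγ.contDiff_two hγ.regular a x
  exact hx.1.ne' <| hγ.simple ⟨hx.1.le, hx.2⟩ ⟨le_rfl, hx.1.trans hx.2⟩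
    (hγ.eq_of_tangent_eq hκ hT)

/-- If the tangent turned twice, it would return to its initial direction inside the period, by the
intermediate value theorem. -/
theorem totalCurvature_eq_two_pi (hab : a < b) (hκ : ∀ u, curvature γ u ≠ 0) :
    totalCurvature a b γ = 2 * Real.pi := by
  have hT : tangent γ b = tangent γ a := by
    simpa using periodic_tangent hγ.periodic a
  have hpos : 0 < totalCurvature a b γ :=
    totalCurvature_pos hγ.contDiff_two hγ.regular hab fun u => hγ.curvature_pos (hκ u)
  have hle : totalCurvature a b γ ≤ 2 * Real.pi := by
    by_contra! hlt
    have hcont : ContinuousOn (totalCurvature a · γ) (Icc a b) := fun x _ =>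
      (hasDerivAt_totalCurvature hγ.contDiff_two hγ.regular a x).continuousAt.continuousWithinAt
    have haa : totalCurvature a a γ = 0 := intervalIntegral.integral_same
    obtain ⟨x, hx, hturn⟩ := intermediate_value_Ioo hab.le hcont
      (show 2 * Real.pi ∈ Ioo _ _ from ⟨haa.trans_lt Real.two_pi_pos, hlt⟩)
    exact hγ.totalCurvature_ne_two_pi hx (hκ x) hturn
  obtain ⟨n, hn⟩ := AddSubgroup.mem_zmultiples_iff.1
    (totalCurvature_mem_zmultiples hγ.contDiff_two hγ.regular hT)
  rw [zsmul_eq_mul] at hn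
  have hn_pos : (0 : ℝ) < n := pos_of_mul_pos_left (hn ▸ hpos) Real.two_pi_pos.le
  have hn_le : (n : ℝ) ≤ 1 :=
    le_of_mul_le_mul_right (by linarith : n * (2 * Real.pi) ≤ 1 * (2 * Real.pi)) Real.two_pi_pos
  have hn_one : n = 1 := le_antisymm (by exact_mod_cast hn_le) (by exact_mod_cast hn_pos)
  rw [← hn, hn_one, Int.cast_one, one_mul]

end IsConvexClosedCurve

/-! ### Variation of closed curves -/

section Variation

variable {S : Set ℝ} {X : ℝ → ℝ → Plane} {a b t : ℝ}

lemma contDiffOn_uncurry_tangent (hS : UniqueDiffOn ℝ S)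
    (hX : ContDiffOn ℝ 2 (uncurry X) (univ ×ˢ S)) (hr : ∀ t ∈ S, ∀ u, deriv (X · t) u ≠ 0) :
    ContDiffOn ℝ 1 (uncurry fun u t => tangent (X · t) u) (univ ×ˢ S) := by
  have hXu := contDiffOn_uncurry_deriv hS hX one_add_one_eq_two.le
  exact ((hXu.norm ℝ fun p hp => hr p.2 hp.2 p.1).inv
    fun p hp => (speed_pos (hr p.2 hp.2 p.1)).ne').smul hXu

theorem totalCurvature_eq_of_isPreconnected (hS : UniqueDiffOn ℝ S) (hSc : IsPreconnected S)
    (hX : ContDiffOn ℝ 2 (uncurry X) (univ ×ˢ S)) (hr : ∀ t ∈ S, ∀ u, deriv (X · t) u ≠ 0)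
    (hp : ∀ t ∈ S, Periodic (X · t) (b - a)) {s : ℝ} (hs : s ∈ S) (ht : t ∈ S) :
    totalCurvature a b (X · s) = totalCurvature a b (X · t) := by
  have hT := contDiffOn_uncurry_tangent hS hX hr
  have hcont : ContinuousOn (fun τ => totalCurvature a b (X · τ)) S := by
    refine (continuousOn_intervalIntegral (a := a) (b := b)
      (G := fun u τ => ⟪deriv (tangent (X · τ)) u, rot (tangent (X · τ) u)⟫) ?_).congr
      fun τ hτ => intervalIntegral.integral_congr fun u _ => curvature_mul_speed (hr τ hτ u)
    exact (contDiffOn_uncurry_deriv (m := 0) hS hT (by simp)).continuousOn.inner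
      (continuous_rot.comp_continuousOn hT.continuousOn)
  refine hSc.constant_of_mapsTo (T := AddSubgroup.zmultiples (2 * Real.pi)) ?_ hcont
    (fun τ hτ => ?_) hs ht
  · exact SetLike.isDiscrete_iff_discreteTopology.2 inferInstance
  · refine totalCurvature_mem_zmultiples (contDiff_slice hX hτ) (hr τ hτ) ?_
    simpa using periodic_tangent (hp τ hτ) a

lemma derivWithin_endpoints_eq (hp : ∀ t ∈ S, Periodic (X · t) (b - a)) (ht : t ∈ S) :
    derivWithin (X b) S t = derivWithin (X a) S t := by
  have hends : EqOn (X b) (X a) S := fun τ hτ => by simpa using hp τ hτ a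
  exact derivWithin_congr hends (hends ht)

theorem hasDerivWithinAt_length (hS : Convex ℝ S) (hSi : (interior S).Nonempty)
    (hX : ContDiffOn ℝ 2 (uncurry X) (univ ×ˢ S)) (hr : ∀ t ∈ S, ∀ u, deriv (X · t) u ≠ 0)
    (hp : ∀ t ∈ S, Periodic (X · t) (b - a)) (ht : t ∈ S) :
    HasDerivWithinAt (fun τ => length a b (X · τ))
      (-∫ u in a..b, curvature (X · t) u * speed (X · t) u *
        ⟪derivWithin (X u) S t, rot (tangent (X · t) u)⟫) S t := by
  have hSd := uniqueDiffOn_convex hS hSi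
  have hScl : S ⊆ closure (interior S) :=
    hS.closure_interior_eq_closure_of_nonempty_interior hSi ▸ subset_closure
  have hV : ContDiffOn ℝ 1 (uncurry fun u τ => derivWithin (X u) S τ) (univ ×ˢ S) :=
    contDiffOn_uncurry_derivWithin hSd hX one_add_one_eq_two.le
  have hVu : ContinuousOn (uncurry fun u τ => deriv (fun v => derivWithin (X v) S τ) u)
      (univ ×ˢ S) := (contDiffOn_uncurry_deriv (m := 0) hSd hV (by simp)).continuousOn
  have hT := contDiffOn_uncurry_tangent hSd hX hr
  have hint : HasDerivWithinAt (fun τ => length a b (X · τ))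
      (∫ u in a..b, ⟪tangent (X · t) u, deriv (fun v => derivWithin (X v) S t) u⟫) S t :=
    hasDerivWithinAt_intervalIntegral hS
      (fun τ hτ => (continuous_speed (contDiff_slice hX hτ)).intervalIntegrable _ _)
      ((hT.continuousOn.inner hVu).mono (prod_mono_left (subset_univ _)))
      (fun u _ τ hτ =>
        hasDerivWithinAt_norm (hasDerivWithinAt_deriv hSd hScl hX hτ u) (hr τ hτ u)) ht
  refine hint.congr_deriv ?_
  rw [integral_inner_deriv_eq_neg (contDiff_slice hT ht) (contDiff_slice hV ht)
    (by simpa using periodic_tangent (hp t ht) a) (derivWithin_endpoints_eq hp ht)]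
  congr 2 with u
  rw [deriv_tangent (contDiff_slice hX ht) (hr t ht), real_inner_smul_left, real_inner_comm]

lemma area_eq_integral_inner (a b : ℝ) (γ : ℝ → Plane) :
    area a b γ = (1 / 2) * ∫ u in a..b, ⟪rot (γ u), deriv γ u⟫ := by
  simp only [area, inner_eq_sum, rot, Matrix.cons_val_zero, Matrix.cons_val_one]
  congr 2 with u
  ring

lemma integral_inner_rot_deriv_add {γ V : ℝ → Plane} (hγ : ContDiff ℝ 1 γ) (hV : ContDiff ℝ 1 V)
    (hγab : γ b = γ a) (hVab : V b = V a) :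
    ∫ u in a..b, (⟪rot (γ u), deriv V u⟫ + ⟪rot (V u), deriv γ u⟫)
      = -2 * ∫ u in a..b, ⟪V u, rot (deriv γ u)⟫ := by
  have hrotγ : ContDiff ℝ 1 fun u => rot (γ u) := contDiff_rot.comp hγ
  have hrotV : ContDiff ℝ 1 fun u => rot (V u) := contDiff_rot.comp hV
  have hparts : ∫ u in a..b, ⟪rot (γ u), deriv V u⟫ = -∫ u in a..b, ⟪V u, rot (deriv γ u)⟫ := by
    rw [integral_inner_deriv_eq_neg hrotγ hV (congrArg rot hγab) hVab]
    congr 2 with u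
    rw [(hasDerivAt_rot (hγ.differentiable one_ne_zero u).hasDerivAt).deriv, real_inner_comm]
  rw [intervalIntegral.integral_add
    ((hrotγ.continuous.inner (hV.continuous_deriv le_rfl)).intervalIntegrable _ _)
    ((hrotV.continuous.inner (hγ.continuous_deriv le_rfl)).intervalIntegrable _ _), hparts]
  simp only [inner_rot_left, intervalIntegral.integral_neg]
  ring

theorem hasDerivWithinAt_area (hS : Convex ℝ S) (hSi : (interior S).Nonempty)
    (hX : ContDiffOn ℝ 2 (uncurry X) (univ ×ˢ S)) (hp : ∀ t ∈ S, Periodic (X · t) (b - a))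
    (ht : t ∈ S) :
    HasDerivWithinAt (fun τ => area a b (X · τ))
      (-∫ u in a..b, ⟪derivWithin (X u) S t, rot (deriv (X · t) u)⟫) S t := by
  have hSd := uniqueDiffOn_convex hS hSi
  have hScl : S ⊆ closure (interior S) :=
    hS.closure_interior_eq_closure_of_nonempty_interior hSi ▸ subset_closure
  set V : ℝ → ℝ → Plane := fun u τ => derivWithin (X u) S τ
  have hV : ContDiffOn ℝ 1 (uncurry V) (univ ×ˢ S) :=
    contDiffOn_uncurry_derivWithin hSd hX one_add_one_eq_two.le
  have hVu : ContinuousOn (uncurry fun u τ => deriv (V · τ) u) (univ ×ˢ S) :=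
    (contDiffOn_uncurry_deriv (m := 0) hSd hV (by simp)).continuousOn
  have hXu : ContinuousOn (uncurry fun u τ => deriv (X · τ) u) (univ ×ˢ S) :=
    (contDiffOn_uncurry_deriv (m := 1) hSd hX one_add_one_eq_two.le).continuousOn
  have hintegrand : ContinuousOn (uncurry fun u τ => ⟪rot (X u τ), deriv (X · τ) u⟫)
      (univ ×ˢ S) := (continuous_rot.comp_continuousOn hX.continuousOn).inner hXu
  have hintegrand' : ContinuousOn (uncurry fun u τ =>
      ⟪rot (X u τ), deriv (V · τ) u⟫ + ⟪rot (V u τ), deriv (X · τ) u⟫) (univ ×ˢ S) :=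
    ((continuous_rot.comp_continuousOn hX.continuousOn).inner hVu).add
      ((continuous_rot.comp_continuousOn hV.continuousOn).inner hXu)
  have hint : HasDerivWithinAt (fun τ => ∫ u in a..b, ⟪rot (X u τ), deriv (X · τ) u⟫)
      (∫ u in a..b, (⟪rot (X u t), deriv (V · t) u⟫ + ⟪rot (V u t), deriv (X · t) u⟫)) S t :=
    hasDerivWithinAt_intervalIntegral hS
      (fun τ hτ => (continuous_slice hintegrand hτ).intervalIntegrable _ _)
      (hintegrand'.mono (prod_mono_left (subset_univ _)))
      (fun u _ τ hτ => (hasDerivWithinAt_rot (hasDerivWithinAt_derivWithin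
        (hX.differentiableOn two_ne_zero) hτ u)).inner ℝ
          (hasDerivWithinAt_deriv hSd hScl hX hτ u)) ht
  simp only [area_eq_integral_inner]
  refine (hint.const_mul (1 / 2)).congr_deriv ?_
  rw [integral_inner_rot_deriv_add ((contDiff_slice hX ht).of_le one_le_two) (contDiff_slice hV ht)
    (by simpa using hp t ht a) (derivWithin_endpoints_eq hp ht)]
  ring

end Variation

/-! ### The normal speed -/

section NormalSpeed

/-- Both `√l - k` and `k - l / k` change sign at `k = √l`. -/
lemma sqrt_mul_sub_div_le {k l : ℝ} (hk : 0 < k) (hl : 0 ≤ l) :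
    √l * (k - l / k) ≤ k * (k - l / k) := by
  have hfactor : k * (k - l / k) - √l * (k - l / k) = (k - √l) ^ 2 * (k + √l) / k := by
    field_simp
    linear_combination (k - √l) * Real.sq_sqrt hl
  have hnonneg : 0 ≤ (k - √l) ^ 2 * (k + √l) / k := by positivity
  linarith

variable {a b : ℝ} {γ : ℝ → Plane} (hγ : ContDiff ℝ 2 γ) (hr : ∀ u, deriv γ u ≠ 0)
include hγ hr

lemma continuous_normalSpeed (hκ : ∀ u, curvature γ u ≠ 0) : Continuous (normalSpeed a b γ) :=
  (continuous_curvature hγ hr).sub (continuous_const.div (continuous_curvature hγ hr) hκ)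

lemma continuous_one_div_curvature_mul_speed (hκ : ∀ u, curvature γ u ≠ 0) :
    Continuous fun u => (1 / curvature γ u) * speed γ u :=
  (continuous_const.div (continuous_curvature hγ hr) hκ).mul (continuous_speed hγ)

variable (hab : a < b) (hκ : ∀ u, 0 < curvature γ u)
include hab hκ

lemma integral_one_div_curvature_mul_speed_pos :
    0 < ∫ u in a..b, (1 / curvature γ u) * speed γ u :=
  intervalIntegral.intervalIntegral_pos_of_pos
    ((continuous_one_div_curvature_mul_speed hγ hr fun u => (hκ u).ne').intervalIntegrable _ _)
    (fun u => mul_pos (one_div_pos.2 (hκ u)) (speed_pos (hr u))) hab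

theorem integral_normalSpeed_mul_speed :
    ∫ u in a..b, normalSpeed a b γ u * speed γ u = totalCurvature a b γ - 2 * Real.pi := by
  have hpos := integral_one_div_curvature_mul_speed_pos hγ hr hab hκ
  have hrecip := continuous_one_div_curvature_mul_speed hγ hr fun u => (hκ u).ne'
  calc ∫ u in a..b, normalSpeed a b γ u * speed γ u
      = ∫ u in a..b, (curvature γ u * speed γ u
          - nonlocalTerm a b γ * ((1 / curvature γ u) * speed γ u)) := by
        congr 1 with u
        rw [normalSpeed]
        ring
    _ = totalCurvature a b γ
          - nonlocalTerm a b γ * ∫ u in a..b, (1 / curvature γ u) * speed γ u := by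
        rw [intervalIntegral.integral_sub
          ((continuous_curvature_mul_speed hγ hr).intervalIntegrable _ _)
          ((hrecip.const_mul _).intervalIntegrable _ _), intervalIntegral.integral_const_mul,
          totalCurvature]
    _ = totalCurvature a b γ - 2 * Real.pi := by
        rw [nonlocalTerm, div_mul_cancel₀ _ hpos.ne']

theorem integral_curvature_mul_speed_mul_normalSpeed_nonneg
    (htotal : totalCurvature a b γ = 2 * Real.pi) :
    0 ≤ ∫ u in a..b, curvature γ u * speed γ u * normalSpeed a b γ u := by
  have hF := continuous_normalSpeed (a := a) (b := b) hγ hr fun u => (hκ u).ne'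
  have hnonlocal : 0 ≤ nonlocalTerm a b γ :=
    (div_pos Real.two_pi_pos (integral_one_div_curvature_mul_speed_pos hγ hr hab hκ)).le
  calc (0 : ℝ) = √(nonlocalTerm a b γ) * ∫ u in a..b, normalSpeed a b γ u * speed γ u := by
        rw [integral_normalSpeed_mul_speed hγ hr hab hκ, htotal, sub_self, mul_zero]
    _ = ∫ u in a..b, √(nonlocalTerm a b γ) * (normalSpeed a b γ u * speed γ u) :=
        (intervalIntegral.integral_const_mul _ _).symm
    _ ≤ ∫ u in a..b, curvature γ u * speed γ u * normalSpeed a b γ u := by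
        refine intervalIntegral.integral_mono hab.le
          ((continuous_const.mul (hF.mul (continuous_speed hγ))).intervalIntegrable _ _)
          (((continuous_curvature_mul_speed hγ hr).mul hF).intervalIntegrable _ _) fun u => ?_
        have hpointwise := mul_le_mul_of_nonneg_right (sqrt_mul_sub_div_le (hκ u) hnonlocal)
          (speed_pos (hr u)).le
        simp only [normalSpeed]
        linarith

end NormalSpeed

/-! ### Solutions of the flow -/

section TimeInterval

variable {T : EReal} {t : ℝ}

lemma convex_timeInterval (T : EReal) : Convex ℝ (timeInterval T) :=
  OrdConnected.convex ⟨fun _ hx _ hy _ hz =>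
    ⟨hx.1.trans hz.1, (EReal.coe_le_coe_iff.2 hz.2).trans_lt hy.2⟩⟩

lemma zero_mem_timeInterval (hT : 0 < T) : 0 ∈ timeInterval T := ⟨le_rfl, hT⟩

lemma interior_timeInterval_nonempty (hT : 0 < T) : (interior (timeInterval T)).Nonempty := by
  obtain ⟨r, hr0, hrT⟩ := EReal.lt_iff_exists_real_btwn.1 hT
  have hsub : Ioo 0 r ⊆ timeInterval T := fun x hx =>
    ⟨hx.1.le, (EReal.coe_lt_coe_iff.2 hx.2).trans hrT⟩
  exact (nonempty_Ioo.2 (EReal.coe_pos.1 hr0)).mono (interior_maximal hsub isOpen_Ioo)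

lemma pos_of_mem_timeInterval (ht : t ∈ timeInterval T) : 0 < T :=
  (EReal.coe_nonneg.2 ht.1).trans_lt ht.2

end TimeInterval

namespace IsSolution

variable {a b : ℝ} {T : EReal} {X₀ : ℝ → Plane} {X : ℝ → ℝ → Plane} {t : ℝ}
  (hX : IsSolution a b T X₀ X)
include hX

lemma contDiffOn_two : ContDiffOn ℝ 2 (uncurry X) (univ ×ˢ timeInterval T) :=
  contDiffOn_infty.1 hX.smooth 2

variable (ht : t ∈ timeInterval T)
include ht

lemma contDiff_two : ContDiff ℝ 2 (X · t) := contDiff_slice hX.contDiffOn_two ht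

lemma inner_derivWithin_rot_tangent (u : ℝ) :
    ⟪derivWithin (X u) (timeInterval T) t, rot (tangent (X · t) u)⟫
      = normalSpeed a b (X · t) u := by
  have hunique : UniqueDiffWithinAt ℝ (timeInterval T) t :=
    uniqueDiffOn_convex (convex_timeInterval T)
      (interior_timeInterval_nonempty (pos_of_mem_timeInterval ht)) t ht
  have hr := hX.regular t ht
  rw [(hX.evolution t ht u).derivWithin hunique,
    normal_eq_rot_tangent (hX.contDiff_two ht) hr (hX.curvature_ne_zero t ht u), inner_add_left,
    real_inner_smul_left, real_inner_smul_left, inner_self_rot, inner_rot_rot,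
    inner_tangent_self (hr u), mul_zero, zero_add, mul_one]

lemma hasDerivWithinAt_length :
    HasDerivWithinAt (fun τ => length a b (X · τ))
      (-∫ u in a..b, curvature (X · t) u * speed (X · t) u * normalSpeed a b (X · t) u)
      (timeInterval T) t := by
  simpa only [hX.inner_derivWithin_rot_tangent ht] using
    CurveFlow.hasDerivWithinAt_length (convex_timeInterval T)
      (interior_timeInterval_nonempty (pos_of_mem_timeInterval ht)) hX.contDiffOn_two hX.regular
      hX.periodic ht

lemma hasDerivWithinAt_area :
    HasDerivWithinAt (fun τ => area a b (X · τ))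
      (-∫ u in a..b, normalSpeed a b (X · t) u * speed (X · t) u) (timeInterval T) t := by
  refine (CurveFlow.hasDerivWithinAt_area (convex_timeInterval T)
    (interior_timeInterval_nonempty (pos_of_mem_timeInterval ht)) hX.contDiffOn_two
    hX.periodic ht).congr_deriv ?_
  congr 2 with u
  rw [← speed_smul_tangent (hX.regular t ht u), rot_smul, real_inner_smul_right,
    hX.inner_derivWithin_rot_tangent ht, mul_comm]

variable (hX₀ : IsConvexClosedCurve a b X₀) (hab : a < b)
include hX₀ hab

theorem totalCurvature_eq_two_pi : totalCurvature a b (X · t) = 2 * Real.pi := by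
  have hT := pos_of_mem_timeInterval ht
  have h0 := zero_mem_timeInterval hT
  have hinitial : (X · 0) = X₀ := funext hX.initial
  have hS := convex_timeInterval T
  calc totalCurvature a b (X · t)
      = totalCurvature a b (X · 0) :=
        totalCurvature_eq_of_isPreconnected
          (uniqueDiffOn_convex hS (interior_timeInterval_nonempty hT)) hS.isPreconnected
          hX.contDiffOn_two hX.regular hX.periodic ht h0
    _ = totalCurvature a b X₀ := by rw [hinitial]
    _ = 2 * Real.pi :=
        hX₀.totalCurvature_eq_two_pi hab (hinitial ▸ hX.curvature_ne_zero 0 h0)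

lemma curvature_pos (u : ℝ) : 0 < curvature (X · t) u :=
  curvature_pos_of_totalCurvature_pos (hX.contDiff_two ht) (hX.regular t ht) hab.le
    (hX.curvature_ne_zero t ht)
    (hX.totalCurvature_eq_two_pi ht hX₀ hab ▸ Real.two_pi_pos) u

end IsSolution

end CurveFlow

end

theorem mainTheorem6 (a b : ℝ) (hab : a < b) (T : EReal) (hT : 0 < T)
    (X₀ : ℝ → CurveFlow.Plane) (hX₀ : CurveFlow.IsConvexClosedCurve a b X₀)
    (X : ℝ → ℝ → CurveFlow.Plane) (hX : CurveFlow.IsSolution a b T X₀ X) :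
    ∀ t ∈ CurveFlow.timeInterval T,
      HasDerivWithinAt (fun τ => CurveFlow.area a b (fun u => X u τ)) 0
        (CurveFlow.timeInterval T) t ∧
      ∃ L' : ℝ,
        HasDerivWithinAt (fun τ => CurveFlow.length a b (fun u => X u τ)) L'
          (CurveFlow.timeInterval T) t ∧
        L' ≤ 0 := by
  intro t ht
  have hγ := hX.contDiff_two ht
  have hr := hX.regular t ht
  have hκ := hX.curvature_pos ht hX₀ hab
  have htotal := hX.totalCurvature_eq_two_pi ht hX₀ hab
  refine ⟨(hX.hasDerivWithinAt_area ht).congr_deriv ?_, _, hX.hasDerivWithinAt_length ht, ?_⟩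
  · rw [CurveFlow.integral_normalSpeed_mul_speed hγ hr hab hκ, htotal, sub_self, neg_zero]
  · exact neg_nonpos.2
      (CurveFlow.integral_curvature_mul_speed_mul_normalSpeed_nonneg hγ hr hab hκ htotal)
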